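/- **Setting.** Fix a function-free first-order signature with a set $\mathbf P$ of predicate symbols (each with an arity) and an infinite set of constants, which is also the Herbrand universe. An *interpretation* is a set of ground atoms; $\mathcal I$ is the set of all interpretations. An *MKNF interpretation* is a nonempty subset of $\mathcal I$. Fix a description logic, i.e. a set of ontology axioms together with a translation $\phi\mapsto\phi^{\mathrm{fo}}$ of axioms to first-order sentences; $\mathrm{pr}(\cdot)$ denotes the set of predicate symbols occurring in an expression, and $\mathrm{pr}(\phi)=\mathrm{pr}(\phi^{\mathrm{fo}})$. A *literal* is a ground atom $p$ or a default literal $\mathord{\sim}p$ (with $\mathord{\sim}\mathord{\sim}p=p$). A *rule* $r$ has a head $H(r)$, which is a literal, and a body $B(r)$, which is a finite set of literals; it is *positive* if $H(r)$ is an atom and a *fact* if $B(r)=\emptyset$. A *program* is a set of rules. A *hybrid knowledge base* is a pair $\langle\mathcal O,\mathcal P\rangle$ of a set $\mathcal O$ of ontology axioms and a program $\mathcal P$; a *dynamic hybrid knowledge base* is a finite sequence of hybrid knowledge bases. **Dynamic stable models.** Let $\mathcal P=\langle\mathcal P_i\rangle_{i<n}$ be a finite sequence of programs (a dynamic logic program)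 and $I\in\mathcal I$. Write $I\models p$ if $p\in I$, $I\models\mathord{\sim}p$ if $p\notin I$, and $I\models B$ if $I\models L$ for all $L\in B$. An occurrence of a rule $r$ in $\mathcal P_i$ is *rejected* if there are $j\ge i$ and $r'\in\mathcal P_j$ with $H(r)=\mathord{\sim}H(r')$ and $I\models B(r')$. Let $Q$ be the program consisting of all rules with a non-rejected occurrence and of all facts $\mathord{\sim}p$ such that no rule $r$ of any $\mathcal P_i$ satisfies $H(r)=p$ and $I\models B(r)$. Then $I$ is a *dynamic stable model* of $\mathcal P$ if $I\cup\{\mathit{not}_p\mid p\notin I\}$ is the least model of the definite program obtained from $Q$ by replacing every default literal $\mathord{\sim}p$ by a fresh atom $\mathit{not}_p$. **Minimal change updates.** For $I,J,J'\in\mathcal I$ write $J\le_I J'$ if, for every predicate symbol $P$, the set of atoms with predicate $P$ on which $I$ and $J$ differ is included in the set of those on which $I$ and $J'$ differ; $J<_I J'$ means $J\le_I J'$ and not $J'\le_I J$. For $M,N\subseteq\mathcal I$ let $M\oplus N=\bigcup_{I\in M}\{J\in N\mid \neg\exists J'\in N: J'<_I J\}$. For first-order theories $T_0,\dots,T_{n-1}$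 with sets of Herbrand models $\mathsf{mod}(T_i)$, the *minimal change update model* of $\langle T_i\rangle_{i<n}$ is $(\cdots((\mathcal I\oplus\mathsf{mod}(T_0))\oplus\mathsf{mod}(T_1))\oplus\cdots)\oplus\mathsf{mod}(T_{n-1})$, provided that it is nonempty. **Basic dynamic hybrid knowledge bases.** Let $\mathcal K=\langle\mathcal K_i\rangle_{i<n}$, $\mathcal K_i=\langle\mathcal O_i,\mathcal P_i\rangle$. It is *$\mathcal O$-based* if every $\mathcal P_i$ contains only positive facts, *$\mathcal P$-based* if every $\mathcal O_i$ is empty, and *basic* if it is one of the two. An MKNF interpretation $M$ is a *dynamic MKNF model of the basic* $\mathcal K$ if either $\mathcal K$ is $\mathcal O$-based and $M$ is the minimal change update model of $\langle\{\phi^{\mathrm{fo}}\mid\phi\in\mathcal O_i\}\cup\{p\mid p\text{ is a fact in }\mathcal P_i\}\rangle_{i<n}$, or $\mathcal K$ is $\mathcal P$-based and $M=\{J\in\mathcal I\mid I\subseteq J\}$ for some dynamic stable model $I$ of $\langle\mathcal P_i\rangle_{i<n}$. **Splitting.** $U\subseteq\mathbf P$ is a *splitting set* for $\langle\mathcal O,\mathcal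 P\rangle$ if $\mathrm{pr}(\phi)\cap U\ne\emptyset$ implies $\mathrm{pr}(\phi)\subseteq U$ for $\phi\in\mathcal O$, and $\mathrm{pr}(H(r))\cap U\neq\emptyset$ implies $\mathrm{pr}(r)\subseteq U$ for $r\in\mathcal P$. The *bottom* $b_U(\langle\mathcal O,\mathcal P\rangle)$ consists of the axioms and rules all of whose predicate symbols are in $U$, and the *top* $t_U(\langle\mathcal O,\mathcal P\rangle)$ of the remaining ones. For $X\subseteq\mathcal I$, the *reduct* $e_U(\langle\mathcal O,\mathcal P\rangle,X)$ has the ontology of the top, and as rules all $r'$ for which there is a rule $r$ of the top with $H(r')=H(r)$, $B(r')=\{L\in B(r)\mid\mathrm{pr}(L)\cap U=\emptyset\}$ and such that, if $X\ne\emptyset$, every atom $p\in B(r)$ with predicate symbol in $U$ belongs to all $J\in X$, and for every $\mathord{\sim}p\in B(r)$ with predicate symbol in $U$ some $J\in X$ does not contain $p$. These operations are applied to dynamic hybrid knowledge bases componentwise. A *splitting sequence* for $\mathcal K$ is a sequence $\langle U_\alpha\rangle_{\alpha<\mu}$, indexed by the ordinals below an ordinal $\mu>0$, of splitting sets for all $\mathcal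 K_i$, which is monotone, continuous ($U_\alpha=\bigcup_{\beta<\alpha}U_\beta$ for limit $\alpha<\mu$) and satisfies $\bigcup_{\alpha<\mu}U_\alpha=\mathbf P$. **Dynamic MKNF models.** $\mathcal K$ is *reducible relative to $V\subseteq\mathbf P$* if either all rules $r$ of all $\mathcal P_i$ are positive with $\mathrm{pr}(B(r))\subseteq V$, or all $\mathcal O_i$ are empty. A splitting sequence $U=\langle U_\alpha\rangle_{\alpha<\mu}$ for $\mathcal K$ is *update-enabling* if $b_{U_0}(\mathcal K)$ is reducible relative to $\emptyset$ and $t_{U_\alpha}(b_{U_{\alpha+1}}(\mathcal K))$ is reducible relative to $U_\alpha$ whenever $\alpha+1<\mu$; $\mathcal K$ is *updatable* if it has an update-enabling splitting sequence. A *solution* to $\mathcal K$ w.r.t. an update-enabling $U$ is a sequence $\langle X_\alpha\rangle_{\alpha<\mu}$ of MKNF interpretations such that $X_0$ is a dynamic MKNF model of the basic $b_{U_0}(\mathcal K)$; $X_{\alpha+1}$ is a dynamic MKNF model of the basic $e_{U_\alpha}\bigl(b_{U_{\alpha+1}}(\mathcal K),\bigcap_{\eta\le\alpha}X_\eta\bigr)$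 whenever $\alpha+1<\mu$; and $X_\alpha=\mathcal I$ for every limit ordinal $\alpha<\mu$. An MKNF interpretation $M$ is a *dynamic MKNF model* of an updatable $\mathcal K$ if $M=\bigcap_{\alpha<\mu}X_\alpha$ for some solution $\langle X_\alpha\rangle_{\alpha<\mu}$ to $\mathcal K$ w.r.t. some update-enabling splitting sequence. **Theorem (Generalisation of Dynamic Stable Model Semantics).** Let $\mathcal K=\langle\mathcal K_i\rangle_{i<n}$, where $\mathcal K_i=\langle\mathcal O_i,\mathcal P_i\rangle$, be a dynamic hybrid knowledge base such that $\mathcal O_i$ is empty for all $i<n$. Then $\mathcal K$ is updatable, and a set $M\subseteq\mathcal I$ is a dynamic MKNF model of $\mathcal K$ if and only if $M=\{J\in\mathcal I\mid I\subseteq J\}$ for some dynamic stable model $I$ of $\langle\mathcal P_i\rangle_{i<n}$. -/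

import Mathlib

universe u v w

namespace HybridUpdate

/-! ### Function-free first-order syntax with the modal operators of MKNF -/

/-- A function-free first-order signature. There are infinitely many constants, and the set of
constants is the Herbrand universe (standard names assumption). -/
structure Signature where
  Pred : Type u
  arity : Pred → ℕ
  Const : Type v
  infinite_const : Infinite Const

/-- Terms with free variables `x₀, …, xₙ₋₁`. -/
inductive Term (S : Signature.{u, v}) (n : ℕ) : Type v
  | var (x : Fin n) : Term S n
  | const (c : S.Const) : Term S n

/-- MKNF formulae with free variables among `x₀, …, xₙ₋₁`; `ex` binds the last variable.
`know` is the modal operator `K` and `naf` is the modal operator `not`. -/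
inductive Formula (S : Signature.{u, v}) : ℕ → Type (max u v)
  | atom {n : ℕ} (P : S.Pred) (ts : Fin (S.arity P) → Term S n) : Formula S n
  | neg {n : ℕ} (φ : Formula S n) : Formula S n
  | conj {n : ℕ} (φ ψ : Formula S n) : Formula S n
  | ex {n : ℕ} (φ : Formula S (n + 1)) : Formula S n
  | know {n : ℕ} (φ : Formula S n) : Formula S n
  | naf {n : ℕ} (φ : Formula S n) : Formula S n

/-- MKNF sentences: formulae without free variables. -/
abbrev Sentence (S : Signature.{u, v}) : Type (max u v) := Formula S 0

namespace Formula

variable {S : Signature.{u, v}}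

/-- The set of predicate symbols relevant to a formula. -/
def preds : {n : ℕ} → Formula S n → Set S.Pred
  | _, .atom P _ => {P}
  | _, .neg φ => φ.preds
  | _, .conj φ ψ => φ.preds ∪ ψ.preds
  | _, .ex φ => φ.preds
  | _, .know φ => φ.preds
  | _, .naf φ => φ.preds

/-- A formula is first-order if it contains no modal operator. -/
def IsFirstOrder : {n : ℕ} → Formula S n → Prop
  | _, .atom _ _ => True
  | _, .neg φ => φ.IsFirstOrder
  | _, .conj φ ψ => φ.IsFirstOrder ∧ ψ.IsFirstOrder
  | _, .ex φ => φ.IsFirstOrder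
  | _, .know _ => False
  | _, .naf _ => False

end Formula

/-! ### Semantics of MKNF -/

/-- Ground atoms `P(c₁, …, cₖ)`. -/
structure GroundAtom (S : Signature.{u, v}) where
  pred : S.Pred
  args : Fin (S.arity pred) → S.Const

/-- Herbrand interpretations, as sets of ground atoms. -/
abbrev Interp (S : Signature.{u, v}) : Type (max u v) := Set (GroundAtom S)

section Semantics

variable {S : Signature.{u, v}}

/-- A ground atom as a sentence. -/
def GroundAtom.toSentence (p : GroundAtom S) : Sentence S :=
  .atom p.pred fun i => .const (p.args i)

/-- The constant denoted by a term when the variables are replaced by the constants `a`. -/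
def Term.eval {n : ℕ} (a : Fin n → S.Const) : Term S n → S.Const
  | .var x => a x
  | .const c => c

/-- Satisfaction in the MKNF structure `(I, M, N)`, the free variables being replaced by the
constants `a`. -/
def Sat (M N : Set (Interp S)) : {n : ℕ} → Interp S → Formula S n → (Fin n → S.Const) → Prop
  | _, I, .atom P ts, a => (⟨P, fun i => (ts i).eval a⟩ : GroundAtom S) ∈ I
  | _, I, .neg φ, a => ¬ Sat M N I φ a
  | _, I, .conj φ ψ, a => Sat M N I φ a ∧ Sat M N I ψ a
  | _, I, .ex φ, a => ∃ c : S.Const, Sat M N I φ (Fin.snoc a c)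
  | _, _, .know φ, a => ∀ J ∈ M, Sat M N J φ a
  | _, _, .naf φ, a => ∃ J ∈ N, ¬ Sat M N J φ a

/-- `M ⊨ T`: every sentence of `T` is true in `(I, M, M)` for every `I ∈ M`. -/
def Models (M : Set (Interp S)) (T : Set (Sentence S)) : Prop :=
  ∀ φ ∈ T, ∀ I ∈ M, Sat M M I φ Fin.elim0

/-- `mod(T)`: the greatest set of interpretations `M` with `M ⊨ T`, whenever there is one.
It is only used for first-order theories, for which there always is one
(see `isGreatest_mod`). -/
def mod (T : Set (Sentence S)) : Set (Interp S) :=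
  ⋃₀ {M | Models M T}

theorem sat_iff_of_isFirstOrder {n : ℕ} (φ : Formula S n) :
    φ.IsFirstOrder → ∀ (M N M' N' : Set (Interp S)) (I : Interp S) (a : Fin n → S.Const),
      Sat M N I φ a ↔ Sat M' N' I φ a := by
  induction φ with
  | atom P ts => intro _ M N M' N' I a; rfl
  | neg φ ih => intro h M N M' N' I a; exact not_congr (ih h M N M' N' I a)
  | conj φ ψ ih₁ ih₂ =>
    intro h M N M' N' I a
    exact and_congr (ih₁ h.1 M N M' N' I a) (ih₂ h.2 M N M' N' I a)
  | ex φ ih => intro h M N M' N' I a; exact exists_congr fun c => ih h M N M' N' I _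
  | know φ ih => intro h; exact h.elim
  | naf φ ih => intro h; exact h.elim

theorem isGreatest_mod (T : Set (Sentence S)) (hT : ∀ φ ∈ T, φ.IsFirstOrder) :
    IsGreatest {M | Models M T} (mod T) := by
  refine ⟨?_, fun M hM => Set.subset_sUnion_of_mem hM⟩
  rintro φ hφ I ⟨M, hM, hI⟩
  exact (sat_iff_of_isFirstOrder φ (hT φ hφ) _ _ _ _ _ _).1 (hM φ hφ I hI)

/-! ### Minimal change updates of first-order theories -/

/-- The difference in the interpretation of the predicate symbol `P` between `I` and `J`. -/
def diff (P : S.Pred) (I J : Interp S) : Set (GroundAtom S) :=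
  ({p ∈ I | p.pred = P} \ {p ∈ J | p.pred = P}) ∪ ({p ∈ J | p.pred = P} \ {p ∈ I | p.pred = P})

/-- `J` is at least as close to `I` as `J'`. -/
def CloserEq (I J J' : Interp S) : Prop :=
  ∀ P : S.Pred, diff P I J ⊆ diff P I J'

/-- `J` is closer to `I` than `J'`. -/
def Closer (I J J' : Interp S) : Prop :=
  CloserEq I J J' ∧ ¬ CloserEq I J' J

/-- `M ⊕ N`: the elements of `N` that are closest to some element of `M`. -/
def update (M N : Set (Interp S)) : Set (Interp S) :=
  ⋃ I ∈ M, {J ∈ N | ¬ ∃ J' ∈ N, Closer I J' J}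

/-- `(⋯((𝓘 ⊕ M₀) ⊕ M₁) ⊕ ⋯) ⊕ Mₙ₋₁`, where `𝓘` is the set of all interpretations. -/
def updateSeq : {n : ℕ} → (Fin n → Set (Interp S)) → Set (Interp S)
  | 0, _ => Set.univ
  | k + 1, M => update (updateSeq fun i : Fin k => M i.castSucc) (M (Fin.last k))

/-- `M` is the minimal change update model of the sequence of first-order theories `T`. -/
def IsMinimalChangeUpdateModel {n : ℕ} (T : Fin n → Set (Sentence S)) (M : Set (Interp S)) :
    Prop :=
  M = updateSeq (fun i => mod (T i)) ∧ M.Nonempty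

end Semantics

/-! ### Generalised and dynamic logic programs -/

/-- Literals: ground atoms and default literals. -/
inductive Literal (S : Signature.{u, v}) : Type (max u v)
  | pos (p : GroundAtom S) : Literal S
  | dneg (p : GroundAtom S) : Literal S

/-- Ground rules. -/
structure Rule (S : Signature.{u, v}) where
  head : Literal S
  body : Finset (Literal S)

/-- Generalised logic programs. -/
abbrev Program (S : Signature.{u, v}) : Type (max u v) := Set (Rule S)

section Programs

variable {S : Signature.{u, v}}

/-- The predicate symbol of a literal. -/
def Literal.pred : Literal S → S.Pred
  | .pos p => p.pred
  | .dneg p => p.pred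

/-- The default negation of a literal; double default negation is absorbed. -/
def Literal.compl : Literal S → Literal S
  | .pos p => .dneg p
  | .dneg p => .pos p

/-- Truth of a literal in an interpretation. -/
def Literal.Holds (I : Interp S) : Literal S → Prop
  | .pos p => p ∈ I
  | .dneg p => p ∉ I

/-- The translation of literals to MKNF: `p` becomes `K p` and `not p` becomes `not p`. -/
def Literal.toMKNF : Literal S → Sentence S
  | .pos p => .know p.toSentence
  | .dneg p => .naf p.toSentence

/-- The predicate symbols occurring in the body of a rule. -/
def Rule.bodyPreds (r : Rule S) : Set S.Pred := {P | ∃ L ∈ r.body, L.pred = P}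

/-- The predicate symbols occurring in a rule. -/
def Rule.preds (r : Rule S) : Set S.Pred := insert r.head.pred r.bodyPreds

/-- A rule is a fact if its body is empty. -/
def Rule.IsFact (r : Rule S) : Prop := r.body = ∅

/-- A rule is positive if its head is an atom. -/
def Rule.IsPositive (r : Rule S) : Prop := ∃ p, r.head = .pos p

/-- `I ⊨ B(r)`. -/
def Rule.BodyHolds (I : Interp S) (r : Rule S) : Prop := ∀ L ∈ r.body, L.Holds I

/-- Two rules are conflicting if the head of one is the default negation of the head of the
other. -/
def Rule.Conflicts (r r' : Rule S) : Prop := r.head = r'.head.compl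

/-- The least model of the definite program that results from replacing every default literal
`not p` by a fresh atom. The elements of `Literal S` serve as the atoms of the extended
vocabulary: `Literal.pos p` is the atom `p` and `Literal.dneg p` is the fresh atom for `not p`. -/
def leastModel (P : Program S) : Set (Literal S) :=
  ⋂₀ {J | ∀ r ∈ P, (∀ L ∈ r.body, L ∈ J) → r.head ∈ J}

/-- `I' = I ∪ {not_p | p ∉ I}`. -/
def extended (I : Interp S) : Set (Literal S) :=
  {L | (∃ p ∈ I, L = .pos p) ∨ ∃ p ∉ I, L = .dneg p}

/-- The multiset of all rules of a dynamic logic program, as the set of the occurrences `(i, r)`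
of rules `r` in its members `P i`. -/
def allRules {n : ℕ} (P : Fin n → Program S) : Set (Fin n × Rule S) :=
  {o | o.2 ∈ P o.1}

/-- The rule occurrences rejected with respect to `I`: an occurrence of a rule is rejected by a
conflicting rule from the same or a later program whose body is true in `I`. -/
def rejected {n : ℕ} (P : Fin n → Program S) (I : Interp S) : Set (Fin n × Rule S) :=
  {o | o.2 ∈ P o.1 ∧ ∃ j, ∃ r' ∈ P j, o.1 ≤ j ∧ o.2.Conflicts r' ∧ r'.BodyHolds I}

/-- The default assumptions with respect to `I`, as facts. -/
def defaults {n : ℕ} (P : Fin n → Program S) (I : Interp S) : Program S :=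
  {r | ∃ p, r = ⟨.dneg p, ∅⟩ ∧ ¬ ∃ o ∈ allRules P, o.2.head = .pos p ∧ o.2.BodyHolds I}

/-- `I` is a dynamic stable model of the dynamic logic program `P` (refined semantics). -/
def IsDynamicStableModel {n : ℕ} (P : Fin n → Program S) (I : Interp S) : Prop :=
  extended I = leastModel (Prod.snd '' (allRules P \ rejected P I) ∪ defaults P I)

end Programs

/-! ### Hybrid knowledge bases -/

/-- A description logic over a signature: a type of ontology assertions together with a
translation of them into first-order sentences. -/
structure DescriptionLogic (S : Signature.{u, v}) where
  Assertion : Type w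
  toFO : Assertion → Sentence S
  toFO_isFirstOrder : ∀ φ, (toFO φ).IsFirstOrder

/-- A hybrid knowledge base: an ontology and a generalised logic program. -/
structure HybridKB {S : Signature.{u, v}} (D : DescriptionLogic.{u, v, w} S) where
  ontology : Set D.Assertion
  program : Program S

/-- A dynamic hybrid knowledge base of length `n`: a finite sequence of hybrid knowledge bases. -/
abbrev DynamicKB {S : Signature.{u, v}} (D : DescriptionLogic.{u, v, w} S) (n : ℕ) :=
  Fin n → HybridKB D

section Splitting

variable {S : Signature.{u, v}} {D : DescriptionLogic.{u, v, w} S}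

namespace HybridKB

/-- `U` is a splitting set for the hybrid knowledge base `K`. -/
def IsSplittingSet (K : HybridKB D) (U : Set S.Pred) : Prop :=
  (∀ φ ∈ K.ontology, ((D.toFO φ).preds ∩ U).Nonempty → (D.toFO φ).preds ⊆ U) ∧
    ∀ r ∈ K.program, r.head.pred ∈ U → r.preds ⊆ U

/-- The bottom of `K` relative to `U`. -/
def bottom (U : Set S.Pred) (K : HybridKB D) : HybridKB D where
  ontology := {φ ∈ K.ontology | (D.toFO φ).preds ⊆ U}
  program := {r ∈ K.program | r.preds ⊆ U}

/-- The top of `K` relative to `U`. -/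
def top (U : Set S.Pred) (K : HybridKB D) : HybridKB D where
  ontology := K.ontology \ (K.bottom U).ontology
  program := K.program \ (K.bottom U).program

/-- The splitting set reduct of `K` relative to `U` and `X`. -/
def reduct (U : Set S.Pred) (K : HybridKB D) (X : Set (Interp S)) : HybridKB D where
  ontology := (K.top U).ontology
  program := {r' | ∃ r ∈ (K.top U).program,
    Models X {φ | ∃ L ∈ r.body, L.pred ∈ U ∧ φ = L.toMKNF} ∧
    r'.head = r.head ∧ ∀ L, L ∈ r'.body ↔ L ∈ r.body ∧ L.pred ∉ U}

/-- The program contains only positive facts. -/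
def IsOBased (K : HybridKB D) : Prop := ∀ r ∈ K.program, r.IsPositive ∧ r.IsFact

/-- The ontology is empty. -/
def IsPBased (K : HybridKB D) : Prop := K.ontology = ∅

/-- All rules are positive and their bodies only contain predicate symbols from `U`. -/
def IsOReducible (K : HybridKB D) (U : Set S.Pred) : Prop :=
  ∀ r ∈ K.program, r.IsPositive ∧ r.bodyPreds ⊆ U

/-- The ontology is empty. -/
def IsPReducible (K : HybridKB D) : Prop := K.ontology = ∅

/-- The first-order theory formed by the translated ontology and by the ground atoms that are
heads of rules; it is used when the program contains only positive facts. -/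
def theory (K : HybridKB D) : Set (Sentence S) :=
  D.toFO '' K.ontology ∪ {φ | ∃ r ∈ K.program, ∃ p, r.head = .pos p ∧ φ = p.toSentence}

end HybridKB

namespace DynamicKB

variable {n : ℕ}

/-- The bottom of a dynamic hybrid knowledge base relative to `U`. -/
def bottom (U : Set S.Pred) (K : DynamicKB D n) : DynamicKB D n := fun i => (K i).bottom U

/-- The top of a dynamic hybrid knowledge base relative to `U`. -/
def top (U : Set S.Pred) (K : DynamicKB D n) : DynamicKB D n := fun i => (K i).top U

/-- The splitting set reduct of a dynamic hybrid knowledge base relative to `U` and `X`. -/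
def reduct (U : Set S.Pred) (K : DynamicKB D n) (X : Set (Interp S)) : DynamicKB D n :=
  fun i => (K i).reduct U X

/-- `M` is a dynamic MKNF model of the basic dynamic hybrid knowledge base `K`. -/
def IsBasicDynamicMKNFModel (K : DynamicKB D n) (M : Set (Interp S)) : Prop :=
  M.Nonempty ∧
    (((∀ i, (K i).IsOBased) ∧ IsMinimalChangeUpdateModel (fun i => (K i).theory) M) ∨
      ((∀ i, (K i).IsPBased) ∧
        ∃ I : Interp S, IsDynamicStableModel (fun i => (K i).program) I ∧ M = {J | I ⊆ J}))

/-- `K` is reducible relative to `U`. -/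
def IsReducible (K : DynamicKB D n) (U : Set S.Pred) : Prop :=
  (∀ i, (K i).IsOReducible U) ∨ ∀ i, (K i).IsPReducible

/-- The monotone and continuous sequence `⟨U α⟩_{α < μ}` of sets of predicate symbols is a
splitting sequence for every member of `K`. The values `U α` for `α ≥ μ` are irrelevant. -/
structure IsSplittingSequence (K : DynamicKB D n) (μ : Ordinal.{u})
    (U : Ordinal.{u} → Set S.Pred) : Prop where
  pos : 0 < μ
  monotone : ∀ α β, α ≤ β → β < μ → U α ⊆ U β
  continuous : ∀ α < μ, Order.IsSuccLimit α → U α = ⋃ β ∈ Set.Iio α, U β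
  splitting : ∀ i, ∀ α < μ, (K i).IsSplittingSet (U α)
  exhaustive : ⋃ α ∈ Set.Iio μ, U α = Set.univ

/-- `⟨U α⟩_{α < μ}` is an update-enabling splitting sequence for `K`. -/
structure IsUpdateEnabling (K : DynamicKB D n) (μ : Ordinal.{u})
    (U : Ordinal.{u} → Set S.Pred) : Prop where
  isSplittingSequence : K.IsSplittingSequence μ U
  reducible_zero : (K.bottom (U 0)).IsReducible ∅
  reducible_succ : ∀ α, α + 1 < μ → ((K.bottom (U (α + 1))).top (U α)).IsReducible (U α)

/-- `K` is updatable if it has an update-enabling splitting sequence. -/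
def IsUpdatable (K : DynamicKB D n) : Prop :=
  ∃ (μ : Ordinal.{u}) (U : Ordinal.{u} → Set S.Pred), K.IsUpdateEnabling μ U

/-- The sequence `⟨X α⟩_{α < μ}` of MKNF interpretations (nonempty sets of interpretations) is a
solution to `K` with respect to `⟨U α⟩_{α < μ}`. -/
structure IsSolution (K : DynamicKB D n) (μ : Ordinal.{u}) (U : Ordinal.{u} → Set S.Pred)
    (X : Ordinal.{u} → Set (Interp S)) : Prop where
  nonempty : ∀ α < μ, (X α).Nonempty
  zero : (K.bottom (U 0)).IsBasicDynamicMKNFModel (X 0)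
  succ : ∀ α, α + 1 < μ →
    ((K.bottom (U (α + 1))).reduct (U α) (⋂ η ∈ Set.Iic α, X η)).IsBasicDynamicMKNFModel
      (X (α + 1))
  limit : ∀ α < μ, Order.IsSuccLimit α → X α = Set.univ

/-- `M` is a dynamic MKNF model of `K` with respect to `⟨U α⟩_{α < μ}`. -/
def IsDynamicMKNFModelWrt (K : DynamicKB D n) (μ : Ordinal.{u}) (U : Ordinal.{u} → Set S.Pred)
    (M : Set (Interp S)) : Prop :=
  M.Nonempty ∧ ∃ X : Ordinal.{u} → Set (Interp S),
    K.IsSolution μ U X ∧ M = ⋂ α ∈ Set.Iio μ, X α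

/-- `M` is a dynamic MKNF model of the updatable dynamic hybrid knowledge base `K`: it is one with
respect to some update-enabling splitting sequence. -/
def IsDynamicMKNFModel (K : DynamicKB D n) (M : Set (Interp S)) : Prop :=
  ∃ (μ : Ordinal.{u}) (U : Ordinal.{u} → Set S.Pred),
    K.IsUpdateEnabling μ U ∧ K.IsDynamicMKNFModelWrt μ U M

end DynamicKB

end Splitting

end HybridUpdate

/-!
Let the level of a predicate symbol be its least index in a splitting sequence. The body literals
of a rule never lie above the level of its head, so in a dynamic stable model the rules with head at
level `α` see the other levels only through the truth values of their lower body literals. Which of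
them are rejected, and which default assumptions concern level `α`, is decided within the level as
well. Hence `I` is a dynamic stable model if and only if, for every `α`, its slice at level `α` is a
dynamic stable model of the rules of level `α` simplified by `I`; and simplifying by `I` agrees with
the splitting set reduct by `⋂ η ≤ α, X η` when each `X η` is the upward closure of a slice.

Two cases need separate attention. A component consisting of positive facts only is evaluated by
minimal change, but updating one upward closed cone by another merely unites their generators, which
yields the only dynamic stable model again. And by continuity no predicate symbol has a limit
ordinal as its level, in accordance with `X α` being unconstrained there.
-/

namespace HybridUpdate

section DefiniteProgram

variable {S : Signature.{u, v}}

theorem leastModel_subset {P : Program S} {T : Set (Literal S)}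
    (h : ∀ r ∈ P, (∀ L ∈ r.body, L ∈ T) → r.head ∈ T) : leastModel P ⊆ T :=
  Set.sInter_subset_of_mem h

theorem head_mem_leastModel {P : Program S} {r : Rule S} (hr : r ∈ P)
    (h : ∀ L ∈ r.body, L ∈ leastModel P) : r.head ∈ leastModel P :=
  fun T hT => hT r hr fun L hL => h L hL T hT

theorem leastModel_mono {P Q : Program S} (h : P ⊆ Q) : leastModel P ⊆ leastModel Q :=
  leastModel_subset fun _ hr => head_mem_leastModel (h hr)

theorem leastModel_subset_image_head (P : Program S) : leastModel P ⊆ Rule.head '' P :=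
  leastModel_subset fun _ hr _ => Set.mem_image_of_mem Rule.head hr

/-- The program consisting of the literals in `B`, viewed as facts. -/
def facts (B : Set (Literal S)) : Program S := {r | r.head ∈ B ∧ r.IsFact}

theorem facts_union (B C : Set (Literal S)) : facts (B ∪ C) = facts B ∪ facts C := by
  ext r
  exact or_and_right

theorem subset_leastModel_facts (B : Set (Literal S)) : B ⊆ leastModel (facts B) := fun L hL =>
  head_mem_leastModel (r := ⟨L, ∅⟩) ⟨hL, rfl⟩ (by simp)

theorem leastModel_facts (B : Set (Literal S)) : leastModel (facts B) = B :=
  (leastModel_subset fun _ hr _ => hr.1).antisymm (subset_leastModel_facts B)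

theorem leastModel_union_facts {P : Program S} {B : Set (Literal S)}
    (hB : ∀ r ∈ P, ∀ L ∈ r.body, L ∉ B) :
    leastModel (P ∪ facts B) = leastModel P ∪ B := by
  refine (leastModel_subset ?_).antisymm (Set.union_subset ?_ ?_)
  · rintro r (hr | hr) hbody
    · exact Or.inl (head_mem_leastModel hr fun L hL => (hbody L hL).resolve_right (hB r hr L hL))
    · exact Or.inr hr.1
  · exact leastModel_mono Set.subset_union_left
  · exact (subset_leastModel_facts B).trans (leastModel_mono Set.subset_union_right)

end DefiniteProgram

section Level

variable {S : Signature.{u, v}} {ι : Type*} [LinearOrder ι] {lvl : S.Pred → ι}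

/-- The program `P` is stratified by the assignment `lvl` of levels to predicate symbols: no body
literal has a higher level than the head. Default negation plays no special role, so this also
admits recursion through it within a level. -/
def IsStratifiedBy (lvl : S.Pred → ι) (P : Program S) : Prop :=
  ∀ r ∈ P, ∀ L ∈ r.body, lvl L.pred ≤ lvl r.head.pred

/-- The rule `r` without the body literals below level `a`. -/
def Rule.truncate (lvl : S.Pred → ι) (a : ι) (r : Rule S) : Rule S where
  head := r.head
  body := {L ∈ r.body | a ≤ lvl L.pred}

theorem Rule.mem_body_truncate {a : ι} {r : Rule S} {L : Literal S} :
    L ∈ (r.truncate lvl a).body ↔ L ∈ r.body ∧ a ≤ lvl L.pred :=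
  Finset.mem_filter

theorem Rule.truncate_eq_iff {a : ι} {r r' : Rule S} :
    r.truncate lvl a = r' ↔
      r'.head = r.head ∧ ∀ L, L ∈ r'.body ↔ L ∈ r.body ∧ a ≤ lvl L.pred := by
  cases r'
  simp only [truncate, mk.injEq, Finset.ext_iff, Finset.mem_filter, eq_comm]

theorem Rule.truncate_eq_self {a : ι} {r : Rule S} (h : ∀ L ∈ r.body, a ≤ lvl L.pred) :
    r.truncate lvl a = r :=
  truncate_eq_iff.2 ⟨rfl, fun L => (and_iff_left_of_imp (h L)).symm⟩

/-- The level `a` of the program `P`: the rules with heads at level `a`, after evaluating in `T`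
the part of their bodies below level `a`. It generalises the splitting set reduct. -/
def levelProgram (lvl : S.Pred → ι) (T : Set (Literal S)) (a : ι) (P : Program S) : Program S :=
  Rule.truncate lvl a ''
    {r ∈ P | lvl r.head.pred = a ∧ ∀ L ∈ r.body, lvl L.pred < a → L ∈ T}

theorem level_head_of_mem_levelProgram {T : Set (Literal S)} {a : ι} {P : Program S} {r : Rule S}
    (hr : r ∈ levelProgram lvl T a P) : lvl r.head.pred = a := by
  obtain ⟨r, ⟨-, ha, -⟩, rfl⟩ := hr
  exact ha

theorem level_body_of_mem_levelProgram {T : Set (Literal S)} {a : ι} {P : Program S}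
    (hP : IsStratifiedBy lvl P) {r : Rule S} (hr : r ∈ levelProgram lvl T a P) {L : Literal S}
    (hL : L ∈ r.body) : lvl L.pred = a := by
  obtain ⟨r, ⟨hr, rfl, -⟩, rfl⟩ := hr
  obtain ⟨hL, hle⟩ := Rule.mem_body_truncate.1 hL
  exact (hP r hr L hL).antisymm hle

theorem levelProgram_union (T : Set (Literal S)) (a : ι) (P Q : Program S) :
    levelProgram lvl T a (P ∪ Q) = levelProgram lvl T a P ∪ levelProgram lvl T a Q := by
  simp only [levelProgram, ← Set.image_union]
  congr 1
  ext r
  exact or_and_right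

theorem levelProgram_facts (T : Set (Literal S)) (a : ι) (B : Set (Literal S)) :
    levelProgram lvl T a (facts B) = facts {L ∈ B | lvl L.pred = a} := by
  ext r
  constructor
  · rintro ⟨r, ⟨⟨hB, hbody⟩, ha, -⟩, rfl⟩
    rw [Rule.IsFact] at hbody
    rw [Rule.truncate_eq_self (by simp [hbody])]
    exact ⟨⟨hB, ha⟩, hbody⟩
  · rintro ⟨⟨hB, ha⟩, hbody⟩
    have hfact := hbody
    rw [Rule.IsFact] at hbody
    exact ⟨r, ⟨⟨hB, hfact⟩, ha, by simp [hbody]⟩, Rule.truncate_eq_self (by simp [hbody])⟩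

theorem leastModel_levelProgram_subset {P : Program S} {T : Set (Literal S)} {a : ι}
    (hT : ∀ L ∈ T, lvl L.pred < a → L ∈ leastModel P) :
    leastModel (levelProgram lvl T a P) ⊆ leastModel P := by
  refine leastModel_subset ?_
  rintro _ ⟨r, ⟨hr, -, hlow⟩, rfl⟩ hupper
  refine head_mem_leastModel (r := r) hr fun L hL => ?_
  obtain hlt | hle := lt_or_ge (lvl L.pred) a
  · exact hT L (hlow L hL hlt) hlt
  · exact hupper L (Rule.mem_body_truncate.2 ⟨hL, hle⟩)

theorem sep_leastModel_eq_leastModel_levelProgram {P : Program S} (hP : IsStratifiedBy lvl P)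
    (a : ι) :
    {L ∈ leastModel P | lvl L.pred = a} =
      leastModel (levelProgram lvl (leastModel P) a P) := by
  refine Set.Subset.antisymm ?_ fun L hL => ⟨leastModel_levelProgram_subset (fun _ h _ => h) hL, ?_⟩
  · suffices h : leastModel P ⊆ {L ∈ leastModel P |
        lvl L.pred = a → L ∈ leastModel (levelProgram lvl (leastModel P) a P)} from
      fun L hL => (h hL.1).2 hL.2
    refine leastModel_subset fun r hr hbody =>
      ⟨head_mem_leastModel hr fun L hL => (hbody L hL).1, fun ha => ?_⟩
    have hmem : r.truncate lvl a ∈ levelProgram lvl (leastModel P) a P :=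
      ⟨r, ⟨hr, ha, fun L hL _ => (hbody L hL).1⟩, rfl⟩
    refine head_mem_leastModel (r := r.truncate lvl a) hmem fun L hL => ?_
    exact (hbody L (Rule.mem_body_truncate.1 hL).1).2 (level_body_of_mem_levelProgram hP hmem hL)
  · obtain ⟨r, hr, rfl⟩ := leastModel_subset_image_head _ hL
    exact level_head_of_mem_levelProgram hr

theorem eq_leastModel_of_forall_level [WellFoundedLT ι] {P : Program S}
    (hP : IsStratifiedBy lvl P) {T : Set (Literal S)} {A : Set ι} (hA : ∀ Q, lvl Q ∈ A)
    (h : ∀ a ∈ A, {L ∈ T | lvl L.pred = a} = leastModel (levelProgram lvl T a P)) :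
    T = leastModel P := by
  have hlevel : ∀ Q, {L ∈ T | lvl L.pred = lvl Q} = leastModel (levelProgram lvl T (lvl Q) P) :=
    fun Q => h _ (hA Q)
  refine Set.Subset.antisymm ?_ (leastModel_subset fun r hr hbody => ?_)
  · suffices hind : ∀ a, ∀ L ∈ T, lvl L.pred = a → L ∈ leastModel P from
      fun L hL => hind _ L hL rfl
    intro a
    induction a using WellFoundedLT.induction with
    | ind a ih =>
      rintro L hL rfl
      exact leastModel_levelProgram_subset (fun L' hL' hlt => ih _ hlt L' hL' rfl)
        ((hlevel L.pred).subset ⟨hL, rfl⟩)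
  · have hmem : r.truncate lvl (lvl r.head.pred) ∈ levelProgram lvl T (lvl r.head.pred) P :=
      ⟨r, ⟨hr, rfl, fun L hL _ => hbody L hL⟩, rfl⟩
    refine ((hlevel r.head.pred).superset (head_mem_leastModel hmem fun L hL => ?_)).1
    rw [← hlevel r.head.pred]
    exact ⟨hbody L (Rule.mem_body_truncate.1 hL).1, level_body_of_mem_levelProgram hP hmem hL⟩

theorem eq_leastModel_iff_forall_level [WellFoundedLT ι] {P : Program S}
    (hP : IsStratifiedBy lvl P) {T : Set (Literal S)} {A : Set ι} (hA : ∀ Q, lvl Q ∈ A) :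
    T = leastModel P ↔
      ∀ a ∈ A, {L ∈ T | lvl L.pred = a} = leastModel (levelProgram lvl T a P) :=
  ⟨fun h a _ => h ▸ sep_leastModel_eq_leastModel_levelProgram hP a,
    eq_leastModel_of_forall_level hP hA⟩

end Level

section DynamicLogicProgram

variable {S : Signature.{u, v}} {n : ℕ} {I : Interp S}

theorem mem_extended {L : Literal S} : L ∈ extended I ↔ L.Holds I := by
  cases L <;> simp [extended, Literal.Holds]

theorem extended_eq_image_union_image (I : Interp S) :
    extended I = Literal.pos '' I ∪ Literal.dneg '' Iᶜ := by
  ext (p | p) <;> simp [mem_extended, Literal.Holds]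

theorem Literal.compl_involutive : Function.Involutive (Literal.compl (S := S)) := by
  rintro (p | p) <;> rfl

theorem Literal.pred_compl (L : Literal S) : L.compl.pred = L.pred := by
  cases L <;> rfl

/-- The program `P` contains a rule with head `L` whose body is true in `I`. -/
def Supports (P : Program S) (I : Interp S) (L : Literal S) : Prop :=
  ∃ r ∈ P, r.head = L ∧ r.BodyHolds I

/-- The rules of `P` that have an occurrence which is not rejected with respect to `I`. -/
def unrejected (P : Fin n → Program S) (I : Interp S) : Program S :=
  Prod.snd '' (allRules P \ rejected P I)

theorem mem_rejected_iff {P : Fin n → Program S} {i : Fin n} {r : Rule S} :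
    (i, r) ∈ rejected P I ↔ r ∈ P i ∧ ∃ j, i ≤ j ∧ Supports (P j) I r.head.compl := by
  have hconflicts (r' : Rule S) : r.Conflicts r' ↔ r'.head = r.head.compl := by
    rw [Rule.Conflicts, eq_comm, Literal.compl_involutive.eq_iff]
  simp only [rejected, Supports, hconflicts, Set.mem_ofPred_eq]
  refine and_congr_right fun _ => exists_congr fun j => ?_
  exact ⟨fun ⟨r', hr', hij, h⟩ => ⟨hij, r', hr', h⟩, fun ⟨hij, r', hr', h⟩ => ⟨r', hr', hij, h⟩⟩

theorem mem_unrejected_iff {P : Fin n → Program S} {r : Rule S} :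
    r ∈ unrejected P I ↔ ∃ i, r ∈ P i ∧ ∀ j, i ≤ j → ¬ Supports (P j) I r.head.compl := by
  simp only [unrejected, allRules, Set.mem_image, Set.mem_sdiff, Set.mem_ofPred_eq, Prod.exists,
    exists_eq_right, mem_rejected_iff]
  exact exists_congr fun i => and_congr_right fun hr => by simp [hr]

theorem defaults_eq_facts (P : Fin n → Program S) (I : Interp S) :
    defaults P I = facts (Literal.dneg '' {p | ∀ i, ¬ Supports (P i) I (.pos p)}) := by
  ext ⟨head, body⟩
  simp only [defaults, facts, Supports, allRules, Rule.IsFact, Set.mem_ofPred_eq, Set.mem_image,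
    Prod.exists, Rule.mk.injEq, not_exists]
  aesop

theorem IsDynamicStableModel.exists_head_eq {P : Fin n → Program S}
    (hI : IsDynamicStableModel P I) {p : GroundAtom S} (hp : p ∈ I) :
    ∃ i, ∃ r ∈ P i, r.head = .pos p := by
  have hmem : Literal.pos p ∈ leastModel (unrejected P I ∪ defaults P I) :=
    hI.subset (mem_extended.2 hp)
  obtain ⟨r, hr | ⟨q, rfl, -⟩, hhead⟩ := leastModel_subset_image_head _ hmem
  · obtain ⟨i, hi, -⟩ := mem_unrejected_iff.1 hr
    exact ⟨i, r, hi, hhead⟩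
  · cases hhead

theorem unrejected_eq_facts_of_positive_facts {P : Fin n → Program S}
    (hP : ∀ i, ∀ r ∈ P i, r.IsPositive ∧ r.IsFact) (I : Interp S) :
    unrejected P I = facts (Literal.pos '' ⋃ i, {p | ∃ r ∈ P i, r.head = .pos p}) := by
  ext r
  rw [mem_unrejected_iff]
  constructor
  · rintro ⟨i, hr, -⟩
    obtain ⟨⟨p, hp⟩, hfact⟩ := hP i r hr
    exact ⟨⟨p, Set.mem_iUnion.2 ⟨i, r, hr, hp⟩, hp.symm⟩, hfact⟩
  · rintro ⟨⟨p, hp, hhead⟩, hfact⟩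
    obtain ⟨i, r', hr', hhead'⟩ := Set.mem_iUnion.1 hp
    obtain rfl : r' = r := by
      cases r
      cases r'
      exact Rule.mk.injEq .. |>.mpr ⟨hhead'.trans hhead, (hP i _ hr').2.trans hfact.symm⟩
    refine ⟨i, hr', fun j _ ⟨s, hs, hcompl, _⟩ => ?_⟩
    obtain ⟨q, hq⟩ := (hP j s hs).1
    simp [← hhead, hq, Literal.compl] at hcompl

theorem defaults_eq_facts_of_facts {P : Fin n → Program S} (hP : ∀ i, ∀ r ∈ P i, r.IsFact)
    (I : Interp S) :
    defaults P I = facts (Literal.dneg '' (⋃ i, {p | ∃ r ∈ P i, r.head = .pos p})ᶜ) := by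
  have hbody {i : Fin n} {r : Rule S} (hr : r ∈ P i) : r.BodyHolds I := by
    have hempty : r.body = ∅ := hP i r hr
    simp [Rule.BodyHolds, hempty]
  rw [defaults_eq_facts]
  congr 2
  ext p
  simp only [Supports, Set.mem_compl_iff, Set.mem_iUnion, Set.mem_ofPred_eq, not_exists]
  exact forall_congr' fun i => forall_congr' fun r =>
    not_congr (and_congr_right fun hr => and_iff_left (hbody hr))

theorem isDynamicStableModel_of_positive_facts {P : Fin n → Program S}
    (hP : ∀ i, ∀ r ∈ P i, r.IsPositive ∧ r.IsFact) :
    IsDynamicStableModel P (⋃ i, {p | ∃ r ∈ P i, r.head = .pos p}) := by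
  rw [IsDynamicStableModel, ← unrejected, unrejected_eq_facts_of_positive_facts hP,
    defaults_eq_facts_of_facts fun i r hr => (hP i r hr).2, ← facts_union, leastModel_facts,
    extended_eq_image_union_image]

/-- The atoms of `I` whose predicate symbol is in `V`. -/
def restrict (V : Set S.Pred) (I : Interp S) : Interp S := {p ∈ I | p.pred ∈ V}

theorem restrict_univ (I : Interp S) : restrict Set.univ I = I := by
  simp [restrict]

theorem iInter_Ici_restrict_preimage {ι : Type*} (f : S.Pred → ι) (s : Set ι) (I : Interp S) :
    ⋂ a ∈ s, Set.Ici (restrict (f ⁻¹' {a}) I) = Set.Ici (restrict (f ⁻¹' s) I) := by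
  ext J
  simp only [restrict, Set.mem_iInter, Set.mem_Ici, Set.subset_def, Set.mem_ofPred_eq,
    Set.mem_preimage, Set.mem_singleton_iff, and_imp]
  exact ⟨fun h p hp hs => h _ hs p hp rfl, fun h a ha p hp hpa => h p hp (hpa ▸ ha)⟩

theorem mem_extended_restrict {V : Set S.Pred} {L : Literal S} (hL : L.pred ∈ V) :
    L ∈ extended (restrict V I) ↔ L ∈ extended I := by
  cases L <;> simp_all [mem_extended, restrict, Literal.Holds, Literal.pred]

theorem extended_restrict (V : Set S.Pred) (I : Interp S) :
    extended (restrict V I) =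
      {L ∈ extended I | L.pred ∈ V} ∪ Literal.dneg '' {p | p.pred ∉ V} := by
  ext (p | p)
  · simp [mem_extended, restrict, Literal.Holds, Literal.pred]
  · simp [mem_extended, restrict, Literal.Holds, Literal.pred]
    tauto

section Level

variable {ι : Type*} [LinearOrder ι] {lvl : S.Pred → ι}

theorem supports_levelProgram_iff {P : Program S} (hP : IsStratifiedBy lvl P) {a : ι}
    {L : Literal S} :
    Supports (levelProgram lvl (extended I) a P) (restrict (lvl ⁻¹' {a}) I) L ↔
      lvl L.pred = a ∧ Supports P I L := by
  constructor
  · rintro ⟨_, ⟨r, ⟨hr, ha, hlow⟩, rfl⟩, rfl, hupper⟩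
    refine ⟨ha, r, hr, rfl, fun L hL => mem_extended.1 ?_⟩
    obtain hlt | hle := lt_or_ge (lvl L.pred) a
    · exact hlow L hL hlt
    · have hLa : lvl L.pred = a := (ha ▸ hP r hr L hL).antisymm hle
      rw [← mem_extended_restrict (V := lvl ⁻¹' {a}) hLa, mem_extended]
      exact hupper L (Rule.mem_body_truncate.2 ⟨hL, hle⟩)
  · rintro ⟨ha, r, hr, rfl, hbody⟩
    have hmem : r.truncate lvl a ∈ levelProgram lvl (extended I) a P :=
      ⟨r, ⟨hr, ha, fun L hL _ => mem_extended.2 (hbody L hL)⟩, rfl⟩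
    refine ⟨_, hmem, rfl, fun L hL => ?_⟩
    rw [← mem_extended, mem_extended_restrict (V := lvl ⁻¹' {a})
      (level_body_of_mem_levelProgram hP hmem hL), mem_extended]
    exact hbody L (Rule.mem_body_truncate.1 hL).1

theorem unrejected_levelProgram {P : Fin n → Program S} (hP : ∀ i, IsStratifiedBy lvl (P i))
    (I : Interp S) (a : ι) :
    unrejected (fun i => levelProgram lvl (extended I) a (P i)) (restrict (lvl ⁻¹' {a}) I) =
      levelProgram lvl (extended I) a (unrejected P I) := by
  ext r'
  simp only [mem_unrejected_iff, supports_levelProgram_iff (hP _), Literal.pred_compl]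
  constructor
  · rintro ⟨i, ⟨r, ⟨hr, ha, hlow⟩, rfl⟩, hunrej⟩
    have hr' : r ∈ unrejected P I :=
      mem_unrejected_iff.2 ⟨i, hr, fun j hij hj => hunrej j hij ⟨ha, hj⟩⟩
    exact ⟨r, ⟨hr', ha, hlow⟩, rfl⟩
  · rintro ⟨r, ⟨hr', ha, hlow⟩, rfl⟩
    obtain ⟨i, hr, hunrej⟩ := mem_unrejected_iff.1 hr'
    exact ⟨i, ⟨r, ⟨hr, ha, hlow⟩, rfl⟩, fun j hij hj => hunrej j hij hj.2⟩

theorem defaults_levelProgram {P : Fin n → Program S} (hP : ∀ i, IsStratifiedBy lvl (P i))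
    (I : Interp S) (a : ι) :
    defaults (fun i => levelProgram lvl (extended I) a (P i)) (restrict (lvl ⁻¹' {a}) I) =
      levelProgram lvl (extended I) a (defaults P I) ∪
        facts (Literal.dneg '' {p | p.pred ∉ lvl ⁻¹' {a}}) := by
  rw [defaults_eq_facts, defaults_eq_facts, levelProgram_facts, ← facts_union]
  congr 1
  ext (p | p)
  · simp
  · by_cases hp : lvl p.pred = a <;> simp [supports_levelProgram_iff (hP _), Literal.pred, hp]

theorem isStratifiedBy_unrejected_union_defaults {P : Fin n → Program S}
    (hP : ∀ i, IsStratifiedBy lvl (P i)) (I : Interp S) :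
    IsStratifiedBy lvl (unrejected P I ∪ defaults P I) := by
  rintro r (hr | ⟨p, rfl, -⟩) L hL
  · obtain ⟨i, hi, -⟩ := mem_unrejected_iff.1 hr
    exact hP i r hi L hL
  · simp at hL

theorem isDynamicStableModel_levelProgram_iff {P : Fin n → Program S}
    (hP : ∀ i, IsStratifiedBy lvl (P i)) (a : ι) :
    IsDynamicStableModel (fun i => levelProgram lvl (extended I) a (P i))
        (restrict (lvl ⁻¹' {a}) I) ↔
      {L ∈ extended I | lvl L.pred = a} =
        leastModel (levelProgram lvl (extended I) a (unrejected P I ∪ defaults P I)) := by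
  -- The default literals `B` of the other levels hold in the restriction and are facts of the level
  -- program; they occur in no other rule of it, so that they can be cancelled.
  set Q := levelProgram lvl (extended I) a (unrejected P I ∪ defaults P I) with hQ
  set B : Set (Literal S) := Literal.dneg '' {p | p.pred ∉ lvl ⁻¹' {a}} with hB
  have hB_level : ∀ L ∈ B, lvl L.pred ≠ a := by
    rintro _ ⟨p, hp, rfl⟩
    exact hp
  have hbody : ∀ r ∈ Q, ∀ L ∈ r.body, L ∉ B := fun r hr L hL hLB => hB_level L hLB <|
    level_body_of_mem_levelProgram (isStratifiedBy_unrejected_union_defaults hP I) hr hL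
  have hdisj_left : Disjoint {L ∈ extended I | lvl L.pred = a} B :=
    Set.disjoint_left.2 fun L hL hLB => hB_level L hLB hL.2
  have hdisj_right : Disjoint (leastModel Q) B := by
    refine Set.disjoint_left.2 fun L hL hLB => hB_level L hLB ?_
    obtain ⟨r, hr, rfl⟩ := leastModel_subset_image_head Q hL
    exact level_head_of_mem_levelProgram hr
  rw [IsDynamicStableModel, ← unrejected, unrejected_levelProgram hP, defaults_levelProgram hP,
    ← Set.union_assoc, ← levelProgram_union, ← hQ, leastModel_union_facts hbody, extended_restrict,
    ← hB]
  refine ⟨fun h => ?_, congrArg (· ∪ B)⟩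
  rw [← hdisj_left.sup_sdiff_cancel_right, ← hdisj_right.sup_sdiff_cancel_right]
  exact congrArg (· \ B) h

theorem isDynamicStableModel_iff_forall_level [WellFoundedLT ι] {P : Fin n → Program S}
    (hP : ∀ i, IsStratifiedBy lvl (P i)) {A : Set ι} (hA : ∀ Q, lvl Q ∈ A) :
    IsDynamicStableModel P I ↔
      ∀ a ∈ A, IsDynamicStableModel (fun i => levelProgram lvl (extended I) a (P i))
        (restrict (lvl ⁻¹' {a}) I) := by
  simp only [isDynamicStableModel_levelProgram_iff hP]
  exact eq_leastModel_iff_forall_level (isStratifiedBy_unrejected_union_defaults hP I) hA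

end Level

end DynamicLogicProgram

section MinimalChange

variable {S : Signature.{u, v}}

open scoped symmDiff

theorem mod_image_toSentence (A : Interp S) : mod (GroundAtom.toSentence '' A) = Set.Ici A := by
  refine Set.Subset.antisymm ?_ fun J hJ => ⟨Set.Ici A, ?_, hJ⟩
  · rintro J ⟨M, hM, hJ⟩ p hp
    exact hM _ (Set.mem_image_of_mem _ hp) J hJ
  · rintro _ ⟨p, hp, rfl⟩ I hI
    exact hI hp

theorem closerEq_iff_symmDiff_subset {I J J' : Interp S} :
    CloserEq I J J' ↔ I ∆ J ⊆ I ∆ J' := by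
  have mem_diff (P : S.Pred) (J : Interp S) (p : GroundAtom S) :
      p ∈ diff P I J ↔ p ∈ I ∆ J ∧ p.pred = P := by
    simp only [diff, Set.mem_symmDiff, Set.mem_union, Set.mem_sdiff, Set.mem_ofPred_eq]
    tauto
  exact ⟨fun h p hp => ((mem_diff _ _ _).1 (h p.pred ((mem_diff _ _ _).2 ⟨hp, rfl⟩))).1,
    fun h P p hp => (mem_diff _ _ _).2 (((mem_diff _ _ _).1 hp).imp_left (@h p))⟩

theorem not_closer_self (I J : Interp S) : ¬ Closer I J I := by
  simp [Closer, closerEq_iff_symmDiff_subset]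

theorem closer_insert {I J : Interp S} {p : GroundAtom S} (hI : p ∈ I) (hJ : p ∉ J) :
    Closer I (insert p J) J := by
  simp only [Closer, closerEq_iff_symmDiff_subset, Set.subset_def, Set.mem_symmDiff,
    Set.mem_insert_iff]
  refine ⟨fun q hq => ?_, fun h => ?_⟩
  · grind
  · simpa [hI] using h p (Or.inl ⟨hI, hJ⟩)

theorem update_Ici (A B : Interp S) : update (Set.Ici A) (Set.Ici B) = Set.Ici (A ∪ B) := by
  ext J
  simp only [update, Set.mem_iUnion, exists_prop]
  constructor
  · rintro ⟨I, hAI, hBJ, hmin⟩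
    refine Set.union_subset (fun p hp => by_contra fun hpJ => ?_) hBJ
    exact hmin ⟨insert p J, hBJ.trans (Set.subset_insert p J), closer_insert (hAI hp) hpJ⟩
  · intro hJ
    exact ⟨J, Set.subset_union_left.trans hJ, Set.subset_union_right.trans hJ,
      fun ⟨J', _, hJ'⟩ => not_closer_self J J' hJ'⟩

theorem updateSeq_Ici {n : ℕ} (A : Fin n → Interp S) :
    updateSeq (fun i => Set.Ici (A i)) = Set.Ici (⋃ i, A i) := by
  induction n with
  | zero => simpa [updateSeq] using (Set.Ici_bot (α := Interp S)).symm
  | succ k ih =>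
    rw [updateSeq, ih fun i => A i.castSucc, update_Ici]
    congr 1
    ext p
    simp [Fin.exists_fin_succ']

end MinimalChange

section BasicModel

variable {S : Signature.{u, v}} {D : DescriptionLogic.{u, v, w} S} {n : ℕ}

theorem HybridKB.theory_eq_of_ontology_eq_empty {K : HybridKB D} (hK : K.ontology = ∅) :
    K.theory = GroundAtom.toSentence '' {p | ∃ r ∈ K.program, r.head = .pos p} := by
  ext φ
  simp only [theory, hK, Set.image_empty, Set.empty_union, Set.mem_image, Set.mem_ofPred_eq]
  exact ⟨fun ⟨r, hr, p, hp, h⟩ => ⟨p, ⟨r, hr, hp⟩, h.symm⟩,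
    fun ⟨p, ⟨r, hr, hp⟩, h⟩ => ⟨r, hr, p, hp, h.symm⟩⟩

theorem DynamicKB.isBasicDynamicMKNFModel_iff {K : DynamicKB D n}
    (hK : ∀ i, (K i).ontology = ∅) {M : Set (Interp S)} :
    K.IsBasicDynamicMKNFModel M ↔
      ∃ I : Interp S, IsDynamicStableModel (fun i => (K i).program) I ∧ M = Set.Ici I := by
  constructor
  · rintro ⟨-, ⟨hfacts, hM, -⟩ | ⟨-, hstable⟩⟩
    · refine ⟨_, isDynamicStableModel_of_positive_facts hfacts, ?_⟩
      simp only [hM, HybridKB.theory_eq_of_ontology_eq_empty (hK _), mod_image_toSentence,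
        updateSeq_Ici]
    · exact hstable
  · rintro ⟨I, hI, rfl⟩
    exact ⟨Set.nonempty_Ici, Or.inr ⟨hK, I, hI, rfl⟩⟩

theorem DynamicKB.isBasicDynamicMKNFModel_Ici_iff {K : DynamicKB D n}
    (hK : ∀ i, (K i).ontology = ∅) {I : Interp S} :
    K.IsBasicDynamicMKNFModel (Set.Ici I) ↔
      IsDynamicStableModel (fun i => (K i).program) I := by
  simp [isBasicDynamicMKNFModel_iff hK, Set.Ici_inj]

theorem models_Ici_image_toMKNF_iff (A : Interp S) (T : Set (Literal S)) :
    Models (Set.Ici A) (Literal.toMKNF '' T) ↔ T ⊆ extended A := by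
  have sat_iff (I : Interp S) (L : Literal S) :
      Sat (Set.Ici A) (Set.Ici A) I L.toMKNF Fin.elim0 ↔ L ∈ extended A := by
    rw [mem_extended]
    cases L with
    | pos p => exact ⟨fun h => h A Set.self_mem_Ici, fun h _ hJ => hJ h⟩
    | dneg p => exact ⟨fun ⟨_, hJ, hp⟩ hA => hp (hJ hA), fun h => ⟨A, Set.self_mem_Ici, h⟩⟩
  simp only [Models, Set.forall_mem_image, sat_iff]
  exact ⟨fun h L hL => h hL A Set.self_mem_Ici, fun h L hL _ _ => h hL⟩

end BasicModel

section Solution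

variable {S : Signature.{u, v}} {D : DescriptionLogic.{u, v, w} S} {n : ℕ}
  {K : DynamicKB D n} {μ : Ordinal.{u}} {U : Ordinal.{u} → Set S.Pred}
  {X : Ordinal.{u} → Set (Interp S)} {I : Interp S}

/-- The least index at which the predicate symbol `P` occurs in the sequence `U`; the junk value
`0` for a `P` that never occurs does not arise for splitting sequences, which are exhaustive. -/
noncomputable def level (U : Ordinal.{u} → Set S.Pred) (P : S.Pred) : Ordinal.{u} :=
  sInf {α | P ∈ U α}

namespace DynamicKB

theorem isUpdateEnabling_univ (hK : ∀ i, (K i).ontology = ∅) :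
    K.IsUpdateEnabling 1 fun _ => Set.univ where
  isSplittingSequence :=
    { pos := zero_lt_one
      monotone := fun _ _ _ _ => subset_rfl
      continuous := fun α hα hlim =>
        absurd (Order.lt_one_iff.1 hα ▸ hlim) Ordinal.not_isSuccLimit_zero
      splitting := fun _ _ _ => ⟨fun _ _ _ => Set.subset_univ _, fun _ _ _ => Set.subset_univ _⟩
      exhaustive := Set.biUnion_const ⟨0, Set.mem_Iio.2 zero_lt_one⟩ _ }
  reducible_zero := Or.inr fun i => by simp [bottom, HybridKB.bottom, HybridKB.IsPReducible, hK]
  reducible_succ := fun α hα => absurd hα (by simp)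

theorem ontology_bottom (hK : ∀ i, (K i).ontology = ∅) (V : Set S.Pred) (i : Fin n) :
    (K.bottom V i).ontology = ∅ := by
  simp [bottom, HybridKB.bottom, hK]

theorem ontology_reduct (hK : ∀ i, (K i).ontology = ∅) (V : Set S.Pred) (Y : Set (Interp S))
    (i : Fin n) : (K.reduct V Y i).ontology = ∅ := by
  simp [reduct, HybridKB.reduct, HybridKB.top, hK]

namespace IsSplittingSequence

theorem exists_mem (hU : K.IsSplittingSequence μ U) (P : S.Pred) : ∃ α < μ, P ∈ U α := by
  simpa using hU.exhaustive.superset (Set.mem_univ P)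

theorem mem_level (hU : K.IsSplittingSequence μ U) (P : S.Pred) : P ∈ U (level U P) := by
  obtain ⟨α, -, hα⟩ := hU.exists_mem P
  exact csInf_mem (s := {α | P ∈ U α}) ⟨α, hα⟩

theorem level_lt (hU : K.IsSplittingSequence μ U) (P : S.Pred) : level U P < μ := by
  obtain ⟨α, hμ, hα⟩ := hU.exists_mem P
  exact (csInf_le' (s := {α | P ∈ U α}) hα).trans_lt hμ

theorem eq_preimage_level_Iic (hU : K.IsSplittingSequence μ U) {α : Ordinal.{u}} (hα : α < μ) :
    U α = level U ⁻¹' Set.Iic α :=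
  Set.ext fun P => ⟨fun h => csInf_le' (s := {α | P ∈ U α}) h,
    fun h => hU.monotone _ _ h hα (hU.mem_level P)⟩

theorem mem_iff_level_le (hU : K.IsSplittingSequence μ U) {α : Ordinal.{u}} (hα : α < μ)
    {P : S.Pred} : P ∈ U α ↔ level U P ≤ α := by
  rw [hU.eq_preimage_level_Iic hα, Set.mem_preimage, Set.mem_Iic]

theorem not_isSuccLimit_level (hU : K.IsSplittingSequence μ U) (P : S.Pred) :
    ¬ Order.IsSuccLimit (level U P) := by
  intro hlim
  have hP : P ∈ ⋃ β ∈ Set.Iio (level U P), U β :=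
    hU.continuous _ (hU.level_lt P) hlim ▸ hU.mem_level P
  simp only [Set.mem_iUnion, Set.mem_Iio, exists_prop] at hP
  obtain ⟨β, hβ, hPβ⟩ := hP
  exact notMem_of_lt_csInf' hβ hPβ

theorem isStratifiedBy_level (hU : K.IsSplittingSequence μ U) (i : Fin n) :
    IsStratifiedBy (level U) (K i).program := fun r hr L hL => by
  have hμ := hU.level_lt r.head.pred
  rw [← hU.mem_iff_level_le hμ]
  exact (hU.splitting i _ hμ).2 r hr (hU.mem_level _) (Or.inr ⟨L, hL, rfl⟩)

theorem preds_subset_iff (hU : K.IsSplittingSequence μ U) {i : Fin n} {r : Rule S}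
    (hr : r ∈ (K i).program) {α : Ordinal.{u}} (hα : α < μ) :
    r.preds ⊆ U α ↔ level U r.head.pred ≤ α := by
  rw [← hU.mem_iff_level_le hα]
  exact ⟨fun h => h (Set.mem_insert _ _), (hU.splitting i α hα).2 r hr⟩

theorem mem_program_bottom_zero_iff (hU : K.IsSplittingSequence μ U) {i : Fin n} {r : Rule S} :
    r ∈ (K.bottom (U 0) i).program ↔ r ∈ (K i).program ∧ level U r.head.pred = 0 :=
  and_congr_right fun hr => (hU.preds_subset_iff hr hU.pos).trans nonpos_iff_eq_zero

theorem mem_program_top_bottom_succ_iff (hU : K.IsSplittingSequence μ U) {α : Ordinal.{u}}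
    (hα : α + 1 < μ) {i : Fin n} {r : Rule S} :
    r ∈ ((K.bottom (U (α + 1))).top (U α) i).program ↔
      r ∈ (K i).program ∧ level U r.head.pred = α + 1 := by
  have hα' : α < μ := (lt_add_one α).trans hα
  simp only [top, bottom, HybridKB.top, HybridKB.bottom, Set.mem_sdiff, Set.mem_ofPred_eq,
    and_assoc]
  refine and_congr_right fun hr => ?_
  simp only [hr, true_and, hU.preds_subset_iff hr hα, hU.preds_subset_iff hr hα', not_and, not_le]
  rw [le_antisymm_iff, Order.add_one_le_iff]
  exact and_congr_right fun hle => ⟨fun h => h hle, fun h _ => h⟩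

theorem program_bottom_zero (hU : K.IsSplittingSequence μ U) (T : Set (Literal S)) (i : Fin n) :
    (K.bottom (U 0) i).program = levelProgram (level U) T 0 (K i).program := by
  ext r
  rw [hU.mem_program_bottom_zero_iff]
  constructor
  · rintro ⟨hr, h0⟩
    exact ⟨r, ⟨hr, h0, by simp⟩, Rule.truncate_eq_self (by simp)⟩
  · rintro ⟨r, ⟨hr, h0, -⟩, rfl⟩
    rw [Rule.truncate_eq_self (by simp)]
    exact ⟨hr, h0⟩

theorem program_reduct_Ici_restrict (hU : K.IsSplittingSequence μ U) (I : Interp S)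
    {α : Ordinal.{u}} (hα : α + 1 < μ) (i : Fin n) :
    ((K.bottom (U (α + 1))).reduct (U α) (Set.Ici (restrict (U α) I)) i).program =
      levelProgram (level U) (extended I) (α + 1) (K i).program := by
  have hα' : α < μ := (lt_add_one α).trans hα
  have models_iff (r : Rule S) :
      Models (Set.Ici (restrict (U α) I)) {φ | ∃ L ∈ r.body, L.pred ∈ U α ∧ φ = L.toMKNF} ↔
        ∀ L ∈ r.body, level U L.pred < α + 1 → L ∈ extended I := by
    have himage : {φ | ∃ L ∈ r.body, L.pred ∈ U α ∧ φ = L.toMKNF} =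
        Literal.toMKNF '' {L | L ∈ r.body ∧ L.pred ∈ U α} := by
      ext φ
      simp [and_assoc, eq_comm]
    rw [himage, models_Ici_image_toMKNF_iff]
    simp only [Set.subset_def, Set.mem_ofPred_eq, and_imp, Order.lt_add_one_iff,
      ← hU.mem_iff_level_le hα']
    exact forall₃_congr fun L _ hL => mem_extended_restrict hL
  have notMem_iff (P : S.Pred) : P ∉ U α ↔ α + 1 ≤ level U P := by
    rw [hU.mem_iff_level_le hα', not_le, Order.add_one_le_iff]
  ext r'
  change (∃ r ∈ ((K.bottom (U (α + 1))).top (U α) i).program, _) ↔ _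
  simp only [levelProgram, Set.mem_image, Set.mem_ofPred_eq, Rule.truncate_eq_iff, models_iff,
    notMem_iff, hU.mem_program_top_bottom_succ_iff hα, and_assoc]

theorem level_head_of_mem_reduct (hU : K.IsSplittingSequence μ U) {α : Ordinal.{u}}
    (hα : α + 1 < μ) {Y : Set (Interp S)} {i : Fin n} {r : Rule S}
    (hr : r ∈ ((K.bottom (U (α + 1))).reduct (U α) Y i).program) :
    level U r.head.pred = α + 1 := by
  obtain ⟨r', hr', -, hhead, -⟩ := hr
  rw [hhead]
  exact ((hU.mem_program_top_bottom_succ_iff hα).1 hr').2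

theorem isBasicDynamicMKNFModel_bottom_zero_iff (hU : K.IsSplittingSequence μ U)
    (hK : ∀ i, (K i).ontology = ∅) (T : Set (Literal S)) :
    (K.bottom (U 0)).IsBasicDynamicMKNFModel (Set.Ici I) ↔
      IsDynamicStableModel (fun i => levelProgram (level U) T 0 (K i).program) I := by
  simp only [isBasicDynamicMKNFModel_Ici_iff (ontology_bottom hK _), hU.program_bottom_zero T]

theorem isBasicDynamicMKNFModel_reduct_iff (hU : K.IsSplittingSequence μ U)
    (hK : ∀ i, (K i).ontology = ∅) {α : Ordinal.{u}} (hα : α + 1 < μ) {J : Interp S} :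
    ((K.bottom (U (α + 1))).reduct (U α) (Set.Ici (restrict (U α) I))).IsBasicDynamicMKNFModel
        (Set.Ici J) ↔
      IsDynamicStableModel
        (fun i => levelProgram (level U) (extended I) (α + 1) (K i).program) J := by
  simp only [isBasicDynamicMKNFModel_Ici_iff (ontology_reduct (ontology_bottom hK _) _ _),
    hU.program_reduct_Ici_restrict I hα]

theorem iInter_Iic_eq_Ici (hU : K.IsSplittingSequence μ U)
    (hX : ∀ α < μ, X α = Set.Ici (restrict (level U ⁻¹' {α}) I)) {α : Ordinal.{u}} (hα : α < μ) :
    ⋂ η ∈ Set.Iic α, X η = Set.Ici (restrict (U α) I) := by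
  rw [hU.eq_preimage_level_Iic hα, ← iInter_Ici_restrict_preimage]
  exact Set.iInter₂_congr fun η hη => hX η (lt_of_le_of_lt hη hα)

theorem iInter_Iio_eq_Ici (hU : K.IsSplittingSequence μ U)
    (hX : ∀ α < μ, X α = Set.Ici (restrict (level U ⁻¹' {α}) I)) :
    ⋂ α ∈ Set.Iio μ, X α = Set.Ici I := by
  have huniv : level U ⁻¹' Set.Iio μ = Set.univ := Set.eq_univ_of_forall hU.level_lt
  calc
    ⋂ α ∈ Set.Iio μ, X α = ⋂ α ∈ Set.Iio μ, Set.Ici (restrict (level U ⁻¹' {α}) I) :=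
      Set.iInter₂_congr hX
    _ = Set.Ici I := by rw [iInter_Ici_restrict_preimage, huniv, restrict_univ]

theorem restrict_level_of_isSuccLimit (hU : K.IsSplittingSequence μ U) {α : Ordinal.{u}}
    (hlim : Order.IsSuccLimit α) (I : Interp S) : restrict (level U ⁻¹' {α}) I = ∅ :=
  Set.eq_empty_of_forall_notMem fun p hp =>
    hU.not_isSuccLimit_level p.pred ((show level U p.pred = α from hp.2) ▸ hlim)

end IsSplittingSequence

theorem isSolution_iff (hK : ∀ i, (K i).ontology = ∅) (hU : K.IsSplittingSequence μ U)
    (hX : ∀ α < μ, X α = Set.Ici (restrict (level U ⁻¹' {α}) I)) :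
    K.IsSolution μ U X ↔ IsDynamicStableModel (fun i => (K i).program) I := by
  rw [isDynamicStableModel_iff_forall_level hU.isStratifiedBy_level
    (A := {α | α < μ ∧ ¬ Order.IsSuccLimit α})
    fun P => ⟨hU.level_lt P, hU.not_isSuccLimit_level P⟩]
  have zero_iff : (K.bottom (U 0)).IsBasicDynamicMKNFModel (X 0) ↔ _ :=
    hX 0 hU.pos ▸ hU.isBasicDynamicMKNFModel_bottom_zero_iff hK (extended I)
  have succ_iff (α : Ordinal.{u}) (hα : α + 1 < μ) :
      ((K.bottom (U (α + 1))).reduct (U α) (⋂ η ∈ Set.Iic α, X η)).IsBasicDynamicMKNFModel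
          (X (α + 1)) ↔
        IsDynamicStableModel
          (fun i => levelProgram (level U) (extended I) (α + 1) (K i).program)
          (restrict (level U ⁻¹' {α + 1}) I) := by
    rw [hX _ hα, hU.iInter_Iic_eq_Ici hX ((lt_add_one α).trans hα)]
    exact hU.isBasicDynamicMKNFModel_reduct_iff hK hα
  constructor
  · rintro h α ⟨hα, hlim⟩
    rcases α.zero_or_succ_or_isSuccLimit with rfl | ⟨β, rfl⟩ | hlim'
    · exact zero_iff.1 h.zero
    · exact (succ_iff β hα).1 (h.succ β hα)
    · exact absurd hlim' hlim
  · intro h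
    refine ⟨fun α hα => hX α hα ▸ Set.nonempty_Ici,
      zero_iff.2 (h 0 ⟨hU.pos, Ordinal.not_isSuccLimit_zero⟩),
      fun α hα => (succ_iff α hα).2 (h _ ⟨hα, Order.not_isSuccLimit_add_one α⟩),
      fun α hα hlim => ?_⟩
    rw [hX α hα, hU.restrict_level_of_isSuccLimit hlim]
    exact Set.Ici_bot

theorem IsSolution.exists_eq_Ici (hK : ∀ i, (K i).ontology = ∅)
    (hU : K.IsSplittingSequence μ U) (hX : K.IsSolution μ U X) {α : Ordinal.{u}} (hα : α < μ) :
    ∃ A : Interp S, X α = Set.Ici A ∧ ∀ p ∈ A, level U p.pred = α := by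
  rcases α.zero_or_succ_or_isSuccLimit with rfl | ⟨β, rfl⟩ | hlim
  · obtain ⟨A, hA, hXA⟩ := (isBasicDynamicMKNFModel_iff (ontology_bottom hK _)).1 hX.zero
    refine ⟨A, hXA, fun p hp => ?_⟩
    obtain ⟨i, r, hr, hhead⟩ := hA.exists_head_eq hp
    simpa only [hhead, Literal.pred] using (hU.mem_program_bottom_zero_iff.1 hr).2
  · obtain ⟨A, hA, hXA⟩ :=
      (isBasicDynamicMKNFModel_iff (ontology_reduct (ontology_bottom hK _) _ _)).1 (hX.succ β hα)
    refine ⟨A, hXA, fun p hp => ?_⟩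
    obtain ⟨i, r, hr, hhead⟩ := hA.exists_head_eq hp
    simpa only [hhead, Literal.pred, Order.succ_eq_add_one] using
      hU.level_head_of_mem_reduct hα hr
  · exact ⟨∅, (hX.limit α hα hlim).trans Set.Ici_bot.symm, by simp⟩

theorem IsSolution.exists_forall_eq_Ici (hK : ∀ i, (K i).ontology = ∅)
    (hU : K.IsSplittingSequence μ U) (hX : K.IsSolution μ U X) :
    ∃ I : Interp S, ∀ α < μ, X α = Set.Ici (restrict (level U ⁻¹' {α}) I) := by
  choose! A hXA hA using fun α hα => hX.exists_eq_Ici hK hU (α := α) hα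
  refine ⟨{p | p ∈ A (level U p.pred)}, fun α hα => ?_⟩
  rw [hXA α hα]
  congr 1
  ext p
  constructor
  · intro hp
    obtain rfl : level U p.pred = α := hA α hα p hp
    exact ⟨hp, rfl⟩
  · rintro ⟨hp, rfl⟩
    exact hp

theorem isDynamicMKNFModelWrt_iff (hK : ∀ i, (K i).ontology = ∅)
    (hU : K.IsSplittingSequence μ U) {M : Set (Interp S)} :
    K.IsDynamicMKNFModelWrt μ U M ↔
      ∃ I : Interp S, IsDynamicStableModel (fun i => (K i).program) I ∧ M = Set.Ici I := by
  constructor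
  · rintro ⟨-, X, hX, rfl⟩
    obtain ⟨I, hXI⟩ := hX.exists_forall_eq_Ici hK hU
    exact ⟨I, (isSolution_iff hK hU hXI).1 hX, hU.iInter_Iio_eq_Ici hXI⟩
  · rintro ⟨I, hI, rfl⟩
    exact ⟨Set.nonempty_Ici, fun α => Set.Ici (restrict (level U ⁻¹' {α}) I),
      (isSolution_iff hK hU fun _ _ => rfl).2 hI, (hU.iInter_Iio_eq_Ici fun _ _ => rfl).symm⟩

end DynamicKB

end Solution

end HybridUpdate

theorem mainTheorem6 {S : HybridUpdate.Signature.{u, v}}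
    {D : HybridUpdate.DescriptionLogic.{u, v, w} S} {n : ℕ} (K : HybridUpdate.DynamicKB D n)
    (hK : ∀ i, (K i).ontology = ∅) :
    HybridUpdate.DynamicKB.IsUpdatable K ∧
      ∀ M : Set (HybridUpdate.Interp S),
        HybridUpdate.DynamicKB.IsDynamicMKNFModel K M ↔
          ∃ I : HybridUpdate.Interp S,
            HybridUpdate.IsDynamicStableModel (fun i => (K i).program) I ∧ M = {J | I ⊆ J} := by
  have isUpdateEnabling := HybridUpdate.DynamicKB.isUpdateEnabling_univ hK
  refine ⟨⟨1, _, isUpdateEnabling⟩, fun M => ⟨?_, fun hM => ?_⟩⟩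
  · rintro ⟨μ, U, hU, hM⟩
    exact (HybridUpdate.DynamicKB.isDynamicMKNFModelWrt_iff hK hU.isSplittingSequence).1 hM
  · have isSplittingSequence := isUpdateEnabling.isSplittingSequence
    exact ⟨1, _, isUpdateEnabling,
      (HybridUpdate.DynamicKB.isDynamicMKNFModelWrt_iff hK isSplittingSequence).2 hM⟩
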